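/- Let $d \ge 2$ be an integer and let $\mathbf t = t_0t_1t_2\cdots$ be the $d$-bonacci word, i.e., the unique infinite word over the alphabet $\{0,1,\dots,d-1\}$ that is fixed by the morphism $\tau$ given by $\tau(a) = 0(a+1)$ for $0 \le a \le d-2$ and $\tau(d-1) = 0$. Let $(D_j)$ be the $d$-bonacci numbers: $D_j = 2^j$ for $0 \le j \le d-1$, $D_j = \sum_{i=1}^{d} D_{j-i}$ for $j \ge d$, and, by convention, $D_{-1} = 1$ and $D_{j} = 0$ for $-d \le j \le -2$. For $n \in \mathbb N$ let the non-repetitive complexity $nr\mathcal C_{\mathbf t}(n)$ be the largest $m \in \mathbb N$ for which there is $\ell \in \mathbb N$ such that $t_i t_{i+1}\cdots t_{i+n-1} \ne t_j t_{j+1} \cdots t_{j+n-1}$ for all $i, j$ with $\ell \le i < j \le \ell+m-1$. Let $n, k$ be positive integers such that $$\frac{1}{d-1}\sum_{i=0}^{d-1}(d-i)D_{k-i-2} - \frac{d}{d-1} < n \le \frac{1}{d-1}\sum_{i=0}^{d-1}(d-i)D_{k-i-1} - \frac{d}{d-1}.$$ Then $$nr\mathcal C_{\mathbf t}(n) = D_{k+1}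 - 1 - \frac{1}{d-1}\sum_{i=0}^{d-1}(d-i)D_{k-i-1} + \frac{d}{d-1} + n.$$ -/

import Mathlib

/-- The factor `u_i u_{i+1} ⋯ u_{i+n-1}` of length `n` at position `i` of the infinite word `u`. -/
def factorAt {α : Type*} (u : ℕ → α) (n i : ℕ) : List α :=
  List.ofFn fun l : Fin n => u (i + l)

/-- The lengths `m` of runs of consecutive positions `k, …, k + m - 1` at which pairwise distinct
factors of length `n` occur in `u`. -/
def nonRepetitiveLengths {α : Type*} (u : ℕ → α) (n : ℕ) : Set ℕ :=
  {m | ∃ k : ℕ, ∀ i j : ℕ, k ≤ i → i < j → j < k + m → factorAt u n i ≠ factorAt u n j}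

/-- The non-repetitive complexity: the largest element of `nonRepetitiveLengths u n`
(over a finite alphabet it exists, see `isGreatest_nonRepetitiveComplexity`). -/
noncomputable def nonRepetitiveComplexity {α : Type*} (u : ℕ → α) (n : ℕ) : ℕ :=
  sSup (nonRepetitiveLengths u n)

/-- Over a finite alphabet the maximum defining the non-repetitive complexity is attained. -/
theorem isGreatest_nonRepetitiveComplexity {α : Type*} [Finite α] (u : ℕ → α) (n : ℕ) :
    IsGreatest (nonRepetitiveLengths u n) (nonRepetitiveComplexity u n) := by
  have hne : (nonRepetitiveLengths u n).Nonempty :=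
    ⟨0, 0, fun i j _ h₁ h₂ => absurd h₂ (by omega)⟩
  have hbdd : BddAbove (nonRepetitiveLengths u n) := by
    refine ⟨Nat.card (Fin n → α), ?_⟩
    rintro m ⟨k, hk⟩
    have hinj : Function.Injective (fun (a : Fin m) (l : Fin n) => u (k + a + l)) := by
      intro a b hab
      by_contra hab_ne
      have hab' : factorAt u n (k + a) = factorAt u n (k + b) :=
        congrArg List.ofFn hab
      have ha := a.isLt
      have hb := b.isLt
      rcases lt_or_gt_of_ne (fun h => hab_ne (Fin.ext h)) with h | h
      · exact hk (k + a) (k + b) (by omega) (by omega) (by omega) hab'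
      · exact hk (k + b) (k + a) (by omega) (by omega) (by omega) hab'.symm
    simpa using Nat.card_le_card_of_injective _ hinj
  exact ⟨Nat.sSup_mem hne hbdd, fun m hm => le_csSup hbdd hm⟩

/-- `v = ψ(u_0) ψ(u_1) ψ(u_2) ⋯`: the concatenations `ψ(u_0) ⋯ ψ(u_{n-1})` are prefixes of `v`,
and their lengths are unbounded. The morphism `ψ` is given by its values on the letters. -/
def IsImageWord {α β : Type*} (ψ : α → List β) (u : ℕ → α) (v : ℕ → β) : Prop :=
  (∀ n : ℕ, (factorAt u n 0).flatMap ψ = factorAt v ((factorAt u n 0).flatMap ψ).length 0) ∧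
    ∀ L : ℕ, ∃ n : ℕ, L ≤ ((factorAt u n 0).flatMap ψ).length

/-- The `d`-bonacci morphism on letters: `a ↦ 0 (a+1)` for `a ≤ d - 2`, and `d - 1 ↦ 0`. -/
def bonacciMorphism (d : ℕ) (a : Fin d) : List (Fin d) :=
  if h : (a : ℕ) + 1 < d then [⟨0, a.pos⟩, ⟨(a : ℕ) + 1, h⟩] else [⟨0, a.pos⟩]

/-- The `d`-bonacci word: the fixed point of the `d`-bonacci morphism
(unique, see `existsUnique_isBonacciWord`). -/
def IsBonacciWord (d : ℕ) (t : ℕ → Fin d) : Prop :=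
  IsImageWord (bonacciMorphism d) t t

/-- The `d`-bonacci numbers `D_0, D_1, …`:
`D_k = 2 ^ k` for `k < d`, and `D_k = D_{k-1} + ⋯ + D_{k-d}` for `k ≥ d`. -/
def bonacciNat (d k : ℕ) : ℕ :=
  if k < d then 2 ^ k else ∑ j : Fin d, bonacciNat d (k - (j + 1))
termination_by k
decreasing_by
  have := j.isLt
  omega

/-- The `d`-bonacci numbers with the convention `D_{-1} = 1` and `D_j = 0` for `j ≤ -2`. -/
def bonacci (d : ℕ) (j : ℤ) : ℕ :=
  if 0 ≤ j then bonacciNat d j.toNat else if j = -1 then 1 else 0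

theorem factorAt_prefix {α : Type*} (u : ℕ → α) {m n : ℕ} (h : m ≤ n) :
    factorAt u m 0 <+: factorAt u n 0 := by
  rw [List.prefix_iff_eq_take]
  apply List.ext_getElem
  · simp [factorAt, h]
  · intro i h₁ h₂
    simp [factorAt]

theorem length_le_length_flatMap {d : ℕ} (w : List (Fin d)) :
    w.length ≤ (w.flatMap (bonacciMorphism d)).length := by
  induction w with
  | nil => simp
  | cons a w ih =>
    have : 1 ≤ (bonacciMorphism d a).length := by
      unfold bonacciMorphism; split <;> simp
    simp only [List.flatMap_cons, List.length_append, List.length_cons]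
    omega

theorem length_lt_length_flatMap {d : ℕ} (hd : 2 ≤ d) (a : Fin d) (ha : (a : ℕ) = 0)
    (w : List (Fin d)) :
    (a :: w).length < ((a :: w).flatMap (bonacciMorphism d)).length := by
  have h1 := length_le_length_flatMap w
  have h2 : (bonacciMorphism d a).length = 2 := by
    unfold bonacciMorphism
    rw [dif_pos (by omega)]
    rfl
  simp only [List.flatMap_cons, List.length_append, List.length_cons, h2]
  omega

theorem bonacciMorphism_eq_cons {d : ℕ} (a : Fin d) :
    ∃ w, bonacciMorphism d a = ⟨0, a.pos⟩ :: w := by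
  unfold bonacciMorphism
  split
  · exact ⟨_, rfl⟩
  · exact ⟨_, rfl⟩

/-- The `d`-bonacci morphism has exactly one fixed point. -/
theorem existsUnique_isBonacciWord (d : ℕ) (hd : 2 ≤ d) : ∃! t, IsBonacciWord d t := by
  let z : Fin d := ⟨0, by omega⟩
  let W : ℕ → List (Fin d) := fun m => (fun w => w.flatMap (bonacciMorphism d))^[m] [z]
  have hsucc : ∀ m, W (m + 1) = (W m).flatMap (bonacciMorphism d) := fun m =>
    Function.iterate_succ_apply' _ _ _
  have hpre : ∀ m, W m <+: W (m + 1) := by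
    intro m
    induction m with
    | zero =>
      obtain ⟨w, hw⟩ := bonacciMorphism_eq_cons z
      rw [hsucc]
      exact ⟨w, by simp [W, hw, z]⟩
    | succ m ih =>
      obtain ⟨s, hs⟩ := ih
      rw [hsucc (m + 1), hsucc m]
      refine ⟨s.flatMap (bonacciMorphism d), ?_⟩
      rw [← List.flatMap_append, hs, hsucc]
  have hmono : ∀ m n, m ≤ n → W m <+: W n := by
    intro m n h
    induction n, h using Nat.le_induction with
    | base => exact List.prefix_rfl
    | succ n _ ih => exact ih.trans (hpre n)
  have hlen : ∀ m, m + 1 ≤ (W m).length := by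
    intro m
    induction m with
    | zero => simp [W]
    | succ m ih =>
      obtain ⟨w, hw⟩ : ∃ w, W m = z :: w := by
        obtain ⟨s, hs⟩ := hmono 0 m (Nat.zero_le m)
        exact ⟨s, by rw [← hs]; rfl⟩
      have := length_lt_length_flatMap hd z rfl w
      rw [hsucc, hw]
      rw [hw] at ih
      omega
  let t : ℕ → Fin d := fun n => (W n)[n]'(hlen n)
  have htW : ∀ m, factorAt t (W m).length 0 = W m := by
    intro m
    apply List.ext_getElem
    · simp [factorAt]
    · intro i h₁ h₂
      have : (W i)[i]'(hlen i) = (W m)[i] := by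
        rcases le_total i m with h | h
        · exact (hmono i m h).getElem (hlen i)
        · exact ((hmono m i h).getElem h₂).symm
      simpa [factorAt, t] using this
  have hlenf : ∀ (u : ℕ → Fin d) n, (factorAt u n 0).length = n := by simp [factorAt]
  have hzero : ∀ u : ℕ → Fin d, IsBonacciWord d u → u 0 = z := by
    intro u hu
    obtain ⟨w, hw⟩ := bonacciMorphism_eq_cons (u 0)
    have h := hu.1 1
    have h1 : factorAt u 1 0 = [u 0] := by simp [factorAt]
    rw [h1, List.flatMap_singleton, hw, List.length_cons] at h
    simp only [factorAt, List.ofFn_succ] at h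
    exact (List.cons.inj h).1.symm
  have HT : ∀ n, (factorAt t n 0).flatMap (bonacciMorphism d)
      = factorAt t ((factorAt t n 0).flatMap (bonacciMorphism d)).length 0 := by
    intro n
    have h1 : factorAt t n 0 <+: W n := by
      rw [← htW n]
      exact factorAt_prefix t (by have := hlen n; omega)
    have h2 : (factorAt t n 0).flatMap (bonacciMorphism d) <+: factorAt t (W (n + 1)).length 0 := by
      rw [htW, hsucc]
      obtain ⟨s, hs⟩ := h1
      exact ⟨s.flatMap (bonacciMorphism d), by rw [← List.flatMap_append, hs]⟩
    have h3 := h2.length_le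
    rw [hlenf] at h3
    exact List.prefix_of_prefix_length_le h2 (factorAt_prefix t h3) (by rw [hlenf]) |>.eq_of_length
      (by rw [hlenf])
  have HL : ∀ L, L ≤ ((factorAt t L 0).flatMap (bonacciMorphism d)).length := by
    intro L
    have := length_le_length_flatMap (factorAt t L 0)
    rwa [hlenf] at this
  refine ⟨t, ⟨HT, fun L => ⟨L, HL L⟩⟩, fun u hu => ?_⟩
  · have ht : IsBonacciWord d t := ⟨HT, fun L => ⟨L, HL L⟩⟩
    have key : ∀ n, factorAt u (n + 1) 0 = factorAt t (n + 1) 0 := by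
      intro n
      induction n with
      | zero => simp [factorAt, hzero u hu, hzero t ht]
      | succ n ih =>
        have h1 := hu.1 (n + 1)
        have h2 := ht.1 (n + 1)
        rw [ih] at h1
        have hlt : n + 2 ≤ ((factorAt t (n + 1) 0).flatMap (bonacciMorphism d)).length := by
          have h3 := length_lt_length_flatMap hd (t 0) (by rw [hzero t ht])
            (List.ofFn fun l : Fin n => t (0 + (l.succ : Fin (n + 1))))
          have h4 : factorAt t (n + 1) 0
              = t 0 :: List.ofFn fun l : Fin n => t (0 + (l.succ : Fin (n + 1))) := by
            simp [factorAt, List.ofFn_succ]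
          rw [← h4, hlenf] at h3
          omega
        have h5 := factorAt_prefix u hlt
        rw [← h1, h2] at h5
        rw [h2] at hlt
        simp only [hlenf] at hlt
        exact (List.prefix_of_prefix_length_le h5 (factorAt_prefix t hlt)
          (by simp only [hlenf]; exact le_rfl)).eq_of_length (by simp only [hlenf])
    funext n
    have h := List.ofFn_injective (key n)
    simpa using congrFun h (Fin.last n)

/-! Write τ for the morphism and cut `t` into the blocks τ^k(t_q); they start at `(blockStart t)^[k]
q`. Put b_k = D_0 + ⋯ + D_{k-1} (`bispecialLength`) and let B_k be the prefix of length b_k. Three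
facts carry the proof. (1) A factor preceded by two different letters is a prefix of `t`. Hence any
repetition, extended to the left as far as possible, becomes a repetition of a prefix
(`exists_agreeAt_zero`). (2) B_k occurs at every boundary of τ^k-blocks (`agreeAt_bispecialLength`).
(3) A prefix longer than b_k occurs only at boundaries of τ^{k+1}-blocks
(`exists_iterate_blockStart`). Thus for b_k < n ≤ b_{k+1} the prefix of length n occurs exactly at
the τ^{k+1}-boundaries, which begin 0, D_{k+1}, D_{k+2}.

Lower bound: the run from b_{k+1} - n + 1 to D_{k+2} - 1 is repetition-free, since the left
extension of a repetition would need two positive τ^{k+1}-boundaries, or one positive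
τ^{k+2}-boundary, below D_{k+2}. Upper bound: a longer run either contains a factor and its
translate by one block, or two consecutive boundaries, at both of which B_{k+1} occurs. Finally, the
weighted sum in the theorem equals d + (d-1) b_k (`sum_mul_bonacci`). -/

/-- The position in the fixed point `t` at which the image of the letter `t q` starts. -/
def blockStart {d : ℕ} (t : ℕ → Fin d) : ℕ → ℕ
  | 0 => 0
  | q + 1 => blockStart t q + if (t q : ℕ) + 1 < d then 2 else 1

/-- The length of the `k`-th iterate of the `d`-bonacci morphism on the letter `a`. -/
def blockLength (d : ℕ) : ℕ → ℕ → ℕ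
  | 0, _ => 1
  | k + 1, a => blockLength d k 0 + if a + 1 < d then blockLength d k (a + 1) else 0

/-- The length `D_0 + ⋯ + D_{k-1}` of the `k`-th bispecial prefix of the `d`-bonacci word. -/
def bispecialLength (d k : ℕ) : ℕ := ∑ j ∈ Finset.range k, blockLength d j 0

/-- The factors of length `n` at the positions `i` and `j` agree. -/
def AgreeAt {α : Type*} (u : ℕ → α) (n i j : ℕ) : Prop := ∀ x < n, u (i + x) = u (j + x)

theorem factorAt_eq_iff {α : Type*} (u : ℕ → α) (n i j : ℕ) :
    factorAt u n i = factorAt u n j ↔ AgreeAt u n i j := by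
  constructor
  · intro h x hx
    exact congrFun (List.ofFn_injective h) ⟨x, hx⟩
  · intro h
    exact congrArg List.ofFn (funext fun x => h x x.isLt)

theorem AgreeAt.mono {α : Type*} {u : ℕ → α} {m n i j : ℕ} (h : AgreeAt u n i j) (hmn : m ≤ n) :
    AgreeAt u m i j := fun x hx => h x (hx.trans_le hmn)

theorem AgreeAt.symm {α : Type*} {u : ℕ → α} {n i j : ℕ} (h : AgreeAt u n i j) :
    AgreeAt u n j i := fun x hx => (h x hx).symm

theorem AgreeAt.trans {α : Type*} {u : ℕ → α} {n i j l : ℕ} (h : AgreeAt u n i j)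
    (h' : AgreeAt u n j l) : AgreeAt u n i l := fun x hx => (h x hx).trans (h' x hx)

theorem AgreeAt.append {α : Type*} {u : ℕ → α} {m n i j : ℕ} (h : AgreeAt u m i j)
    (h' : AgreeAt u n (i + m) (j + m)) : AgreeAt u (m + n) i j := by
  intro x hx
  rcases lt_or_ge x m with hxm | hxm
  · exact h x hxm
  · have := h' (x - m) (by omega)
    rwa [show i + m + (x - m) = i + x by omega, show j + m + (x - m) = j + x by omega] at this

theorem AgreeAt.drop {α : Type*} {u : ℕ → α} {m n i j : ℕ} (h : AgreeAt u (m + n) i j) :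
    AgreeAt u n (i + m) (j + m) := by
  intro x hx
  simpa [add_assoc] using h (m + x) (by omega)

theorem agreeAt_one {α : Type*} {u : ℕ → α} {i j : ℕ} : AgreeAt u 1 i j ↔ u i = u j := by
  constructor
  · intro h; simpa using h 0 one_pos
  · intro h x hx
    obtain rfl : x = 0 := by omega
    simpa using h

/-! ### Desubstitution: the word as a sequence of images of letters -/

section
variable {d : ℕ} {t : ℕ → Fin d}

theorem length_bonacciMorphism (a : Fin d) :
    (bonacciMorphism d a).length = if (a : ℕ) + 1 < d then 2 else 1 := by
  unfold bonacciMorphism; split <;> simp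

theorem factorAt_succ {α : Type*} (u : ℕ → α) (n : ℕ) :
    factorAt u (n + 1) 0 = factorAt u n 0 ++ [u n] := by
  simp only [factorAt, List.ofFn_succ', List.concat_eq_append, Fin.val_castSucc, Fin.val_last,
    zero_add]

theorem length_flatMap_factorAt (t : ℕ → Fin d) (q : ℕ) :
    ((factorAt t q 0).flatMap (bonacciMorphism d)).length = blockStart t q := by
  induction q with
  | zero => simp [factorAt, blockStart]
  | succ q ih =>
    rw [factorAt_succ, List.flatMap_append, List.length_append, ih, List.flatMap_singleton,
      length_bonacciMorphism, blockStart]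

theorem IsBonacciWord.getElem_bonacciMorphism (ht : IsBonacciWord d t) (q x : ℕ)
    (hx : x < (bonacciMorphism d (t q)).length) :
    t (blockStart t q + x) = (bonacciMorphism d (t q))[x] := by
  have h := ht.1 (q + 1)
  rw [factorAt_succ, List.flatMap_append, List.flatMap_singleton] at h
  have h1 := congrArg (fun l => l[blockStart t q + x]?) h
  simp only [← length_flatMap_factorAt t q] at h1 ⊢
  rw [List.getElem?_append_right (by omega)] at h1
  simp only [add_tsub_cancel_left, List.getElem?_eq_getElem hx] at h1
  simp only [List.length_append, factorAt, List.getElem?_ofFn] at h1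
  split at h1
  · simp only [factorAt]
    simpa using h1.symm
  · simp at h1

theorem IsBonacciWord.apply_blockStart (ht : IsBonacciWord d t) (q : ℕ) :
    (t (blockStart t q) : ℕ) = 0 := by
  obtain ⟨w, hw⟩ := bonacciMorphism_eq_cons (t q)
  have := ht.getElem_bonacciMorphism q 0 (by simp [hw])
  simp only [hw, add_zero] at this
  rw [this]; rfl

theorem IsBonacciWord.apply_blockStart_add_one (ht : IsBonacciWord d t) (q : ℕ)
    (hq : (t q : ℕ) + 1 < d) : (t (blockStart t q + 1) : ℕ) = t q + 1 := by
  have hw : bonacciMorphism d (t q) = [⟨0, (t q).pos⟩, ⟨(t q : ℕ) + 1, hq⟩] := by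
    rw [bonacciMorphism, dif_pos hq]
  have := ht.getElem_bonacciMorphism q 1 (by simp [hw])
  simp only [hw] at this
  rw [this]; rfl

theorem blockStart_strictMono (t : ℕ → Fin d) : StrictMono (blockStart t) := by
  refine strictMono_nat_of_lt_succ fun q => ?_
  rw [blockStart]; split <;> omega

theorem le_blockStart (t : ℕ → Fin d) (q : ℕ) : q ≤ blockStart t q :=
  (blockStart_strictMono t).le_apply

theorem blockStart_succ_of_lt {q : ℕ} (h : (t q : ℕ) + 1 < d) :
    blockStart t (q + 1) = blockStart t q + 2 := by
  rw [blockStart, if_pos h]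

theorem blockStart_succ_of_not_lt {q : ℕ} (h : ¬ (t q : ℕ) + 1 < d) :
    blockStart t (q + 1) = blockStart t q + 1 := by
  rw [blockStart, if_neg h]

theorem exists_blockStart_eq_or (t : ℕ → Fin d) (x : ℕ) :
    ∃ q, x = blockStart t q ∨ (t q : ℕ) + 1 < d ∧ x = blockStart t q + 1 := by
  induction x with
  | zero => exact ⟨0, Or.inl rfl⟩
  | succ x ih =>
    obtain ⟨q, rfl | ⟨hq, rfl⟩⟩ := ih
    · by_cases hq : (t q : ℕ) + 1 < d
      · exact ⟨q, Or.inr ⟨hq, rfl⟩⟩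
      · exact ⟨q + 1, Or.inl (blockStart_succ_of_not_lt hq).symm⟩
    · exact ⟨q + 1, Or.inl (blockStart_succ_of_lt hq).symm⟩

theorem IsBonacciWord.exists_of_apply_eq_zero (ht : IsBonacciWord d t) {x : ℕ}
    (hx : (t x : ℕ) = 0) : ∃ q, x = blockStart t q := by
  obtain ⟨q, h | ⟨hq, rfl⟩⟩ := exists_blockStart_eq_or t x
  · exact ⟨q, h⟩
  · rw [ht.apply_blockStart_add_one q hq] at hx
    omega

theorem IsBonacciWord.apply_succ_eq_zero (ht : IsBonacciWord d t) {x : ℕ}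
    (hx : (t x : ℕ) ≠ 0) : (t (x + 1) : ℕ) = 0 := by
  obtain ⟨q, rfl | ⟨hq, rfl⟩⟩ := exists_blockStart_eq_or t x
  · exact absurd (ht.apply_blockStart q) hx
  · rw [add_assoc, one_add_one_eq_two, ← blockStart_succ_of_lt hq]
    exact ht.apply_blockStart _

theorem IsBonacciWord.apply_zero (ht : IsBonacciWord d t) : (t 0 : ℕ) = 0 :=
  ht.apply_blockStart 0

/-- Equal factors have images of equal length; written additively to avoid truncated subtraction. -/
theorem AgreeAt.blockStart_add {q q' m : ℕ} (h : AgreeAt t m q q') :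
    blockStart t (q + m) + blockStart t q' = blockStart t (q' + m) + blockStart t q := by
  induction m with
  | zero => simp [add_comm]
  | succ m ih =>
    have h1 := ih (h.mono m.le_succ)
    have h2 := h m m.lt_succ_self
    rw [← add_assoc, ← add_assoc, blockStart, blockStart, h2]
    omega

/-- Equal factors have equal images, and the next letter is `0` in both cases. -/
theorem IsBonacciWord.agreeAt_blockStart (ht : IsBonacciWord d t) {q q' m : ℕ}
    (h : AgreeAt t m q q') :
    AgreeAt t (blockStart t (q + m) - blockStart t q + 1) (blockStart t q) (blockStart t q') := by
  induction m with
  | zero =>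
    simp only [add_zero, Nat.sub_self, zero_add, agreeAt_one]
    exact Fin.ext (by rw [ht.apply_blockStart, ht.apply_blockStart])
  | succ m ih =>
    have h1 := ih (h.mono m.le_succ)
    have h2 := h m m.lt_succ_self
    have h3 := (h.mono m.le_succ).blockStart_add
    have h4 := (blockStart_strictMono t).monotone (Nat.le_add_right q m)
    have h5 := (blockStart_strictMono t).monotone (Nat.le_add_right q' m)
    -- The initial 0 of the new block is already covered by `h1`, so the window is shifted by one:
    -- the rest of this block and the initial 0 of the next.
    have key : AgreeAt t (blockStart t (q + m + 1) - blockStart t (q + m))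
        (blockStart t (q + m) + 1) (blockStart t (q' + m) + 1) := by
      have z : t (blockStart t (q + m + 1)) = t (blockStart t (q' + m + 1)) :=
        Fin.ext (by rw [ht.apply_blockStart, ht.apply_blockStart])
      by_cases hq : (t (q + m) : ℕ) + 1 < d
      · have hq' := hq
        rw [h2] at hq'
        rw [blockStart_succ_of_lt hq, blockStart_succ_of_lt hq'] at z
        rw [blockStart_succ_of_lt hq, add_tsub_cancel_left]
        refine AgreeAt.append (m := 1) (n := 1) (agreeAt_one.2 (Fin.ext ?_)) (agreeAt_one.2 z)
        rw [ht.apply_blockStart_add_one _ hq, ht.apply_blockStart_add_one _ hq', h2]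
      · have hq' := hq
        rw [h2] at hq'
        rw [blockStart_succ_of_not_lt hq, blockStart_succ_of_not_lt hq'] at z
        rw [blockStart_succ_of_not_lt hq, add_tsub_cancel_left]
        exact agreeAt_one.2 z
    have h6 := (blockStart_strictMono t).monotone (Nat.le_succ (q + m))
    have h7 := h1.append (n := blockStart t (q + m + 1) - blockStart t (q + m))
      (by convert key using 1 <;> omega)
    refine h7.mono ?_
    simp only [Nat.succ_eq_add_one] at h6
    rw [← add_assoc]
    omega

/-- The letter after the initial 0 of τ(a) is a + 1 modulo d: it is 0, from the next block, exactly
when a = d - 1. So it determines a. -/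
theorem IsBonacciWord.apply_eq_of_agreeAt (ht : IsBonacciWord d t) {q q' : ℕ}
    (h : t (blockStart t q + 1) = t (blockStart t q' + 1)) : t q = t q' := by
  have aux : ∀ p, ((t p : ℕ) + 1 < d ∧ (t (blockStart t p + 1) : ℕ) = t p + 1) ∨
      ((t p : ℕ) + 1 = d ∧ (t (blockStart t p + 1) : ℕ) = 0) := by
    intro p
    by_cases hp : (t p : ℕ) + 1 < d
    · exact Or.inl ⟨hp, ht.apply_blockStart_add_one p hp⟩
    · refine Or.inr ⟨by have := (t p).isLt; omega, ?_⟩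
      rw [← blockStart_succ_of_not_lt hp]
      exact ht.apply_blockStart _
  have h1 := aux q
  have h2 := aux q'
  rw [h] at h1
  apply Fin.ext
  omega

/-- Equal factors starting at block boundaries can be desubstituted. -/
theorem IsBonacciWord.agreeAt_of_blockStart (ht : IsBonacciWord d t) {q q' m n : ℕ}
    (h : AgreeAt t n (blockStart t q) (blockStart t q'))
    (hm : ∀ r < m, blockStart t (q + r) - blockStart t q + 1 < n) :
    AgreeAt t m q q' := by
  induction m with
  | zero => intro x hx; omega
  | succ m ih =>
    have h1 := ih fun r hr => hm r (hr.trans m.lt_succ_self)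
    refine h1.append (agreeAt_one.2 (ht.apply_eq_of_agreeAt ?_))
    have h2 := h _ (hm m m.lt_succ_self)
    have h3 := h1.blockStart_add
    have h4 := (blockStart_strictMono t).monotone (Nat.le_add_right q m)
    have h5 := (blockStart_strictMono t).monotone (Nat.le_add_right q' m)
    convert h2 using 2 <;> omega

/-- The last letter of τ(a) depends only on a, so left-speciality passes to the preimage. -/
theorem IsBonacciWord.apply_pred_ne (ht : IsBonacciWord d t) {q q' : ℕ}
    (h : t (blockStart t (q + 1) - 1) ≠ t (blockStart t (q' + 1) - 1)) : t q ≠ t q' := by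
  intro hqq
  apply h
  by_cases hq : (t q : ℕ) + 1 < d
  · have hq' := hq
    rw [hqq] at hq'
    rw [blockStart_succ_of_lt hq, blockStart_succ_of_lt hq']
    apply Fin.ext
    simp only [Nat.add_succ_sub_one]
    rw [ht.apply_blockStart_add_one _ hq, ht.apply_blockStart_add_one _ hq', hqq]
  · have hq' := hq
    rw [hqq] at hq'
    rw [blockStart_succ_of_not_lt hq, blockStart_succ_of_not_lt hq']
    apply Fin.ext
    rw [add_tsub_cancel_right, add_tsub_cancel_right, ht.apply_blockStart, ht.apply_blockStart]

/-! ### Left special factors and left extension of repetitions -/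

/-- Left special factors of the `d`-bonacci word are prefixes. -/
theorem IsBonacciWord.agreeAt_zero_of_leftSpecial (ht : IsBonacciWord d t) {n i j : ℕ}
    (h : AgreeAt t n (i + 1) (j + 1)) (hne : t i ≠ t j) : AgreeAt t n (i + 1) 0 := by
  induction n using Nat.strong_induction_on generalizing i j with
  | _ n ih =>
    rcases Nat.eq_zero_or_pos n with rfl | hn
    · intro x hx; omega
    have h0 : t (i + 1) = t (j + 1) := h 0 hn
    -- One of the two distinct preceding letters is nonzero, and a nonzero letter is always followed
    -- by 0.
    have hz : (t (i + 1) : ℕ) = 0 := by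
      by_cases hi : (t i : ℕ) = 0
      · rw [h0]
        exact ht.apply_succ_eq_zero fun hj => hne (Fin.ext (hi.trans hj.symm))
      · exact ht.apply_succ_eq_zero hi
    obtain ⟨q, hq⟩ := ht.exists_of_apply_eq_zero hz
    obtain ⟨q', hq'⟩ := ht.exists_of_apply_eq_zero (h0 ▸ hz)
    obtain _ | q := q
    · simp [blockStart] at hq
    obtain _ | q' := q'
    · simp [blockStart] at hq'
    have hne' : t q ≠ t q' := by
      apply ht.apply_pred_ne
      rwa [← hq, ← hq', add_tsub_cancel_right, add_tsub_cancel_right]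
    rw [hq, hq'] at h
    rw [hq]
    -- Take the fewest blocks which, with the 0 that follows them, cover the window; their preimage
    -- is a shorter left special factor.
    have hex : ∃ m, n ≤ blockStart t (q + 1 + m) - blockStart t (q + 1) + 1 := by
      refine ⟨n + blockStart t (q + 1), ?_⟩
      have := le_blockStart t (q + 1 + (n + blockStart t (q + 1)))
      omega
    classical
    have hmin := fun r => Nat.find_min hex (m := r)
    have hspec := Nat.find_spec hex
    set m := Nat.find hex
    have h1 : AgreeAt t m (q + 1) (q' + 1) :=
      ht.agreeAt_of_blockStart h fun r hr => not_le.1 (hmin r hr)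
    have hmn : m < n := by
      rcases Nat.eq_zero_or_pos m with h0 | hpos
      · omega
      · have h2 := not_le.1 (hmin (m - 1) (by omega))
        have h3 := (blockStart_strictMono t).add_le_nat (m - 1) (q + 1)
        rw [add_comm (m - 1) (q + 1)] at h3
        omega
    exact (ht.agreeAt_blockStart (ih m hmn h1 hne')).mono hspec

/-- A repetition extends to the left to a repetition of a prefix. -/
theorem IsBonacciWord.exists_agreeAt_zero (ht : IsBonacciWord d t) {n i j : ℕ} (hij : i < j)
    (h : AgreeAt t n i j) :
    ∃ a ≤ i, AgreeAt t (n + a) (i - a) 0 ∧ AgreeAt t (n + a) (j - a) 0 := by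
  induction i generalizing j n with
  | zero =>
    exact ⟨0, le_rfl, fun _ _ => rfl, h.symm⟩
  | succ i ih =>
    obtain _ | j := j
    · omega
    by_cases hne : t i = t j
    · obtain ⟨a, ha, h1, h2⟩ := ih (n := 1 + n) (j := j) (by omega)
        ((agreeAt_one.2 hne).append h)
      exact ⟨a + 1, by omega, by convert h1 using 1 <;> omega, by convert h2 using 1 <;> omega⟩
    · have h1 := ht.agreeAt_zero_of_leftSpecial h hne
      exact ⟨0, by omega, h1, h.symm.trans h1⟩

/-! ### Iterated blocks and occurrences of prefixes -/

theorem iterate_blockStart_zero (t : ℕ → Fin d) (k : ℕ) : (blockStart t)^[k] 0 = 0 := by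
  induction k with
  | zero => rfl
  | succ k ih => rw [Function.iterate_succ_apply, blockStart, ih]

theorem iterate_blockStart_strictMono (t : ℕ → Fin d) (k : ℕ) : StrictMono (blockStart t)^[k] :=
  (blockStart_strictMono t).iterate k

theorem IsBonacciWord.iterate_blockStart_succ (ht : IsBonacciWord d t) (k q : ℕ) :
    (blockStart t)^[k] (q + 1) = (blockStart t)^[k] q + blockLength d k (t q) := by
  induction k generalizing q with
  | zero => rfl
  | succ k ih =>
    rw [Function.iterate_succ_apply, Function.iterate_succ_apply, blockLength]
    split_ifs with hq
    · rw [blockStart_succ_of_lt hq, ih, ih, ht.apply_blockStart, ht.apply_blockStart_add_one q hq,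
        add_assoc]
    · rw [blockStart_succ_of_not_lt hq, ih, ht.apply_blockStart, add_zero]

theorem IsBonacciWord.iterate_blockStart_one (ht : IsBonacciWord d t) (k : ℕ) :
    (blockStart t)^[k] 1 = blockLength d k 0 := by
  have := ht.iterate_blockStart_succ k 0
  rwa [zero_add, iterate_blockStart_zero, zero_add, ht.apply_zero] at this

theorem IsBonacciWord.iterate_blockStart_two (ht : IsBonacciWord d t) (hd : 2 ≤ d) (k : ℕ) :
    (blockStart t)^[k] 2 = blockLength d (k + 1) 0 := by
  rw [← ht.iterate_blockStart_one, Function.iterate_succ_apply,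
    show blockStart t 1 = 2 by
      rw [← zero_add 1, blockStart_succ_of_lt (by rw [ht.apply_zero]; omega)]; rfl]

theorem IsBonacciWord.agreeAt_iterate_blockStart (ht : IsBonacciWord d t) (k : ℕ) {q q' : ℕ}
    (h : t q = t q') :
    AgreeAt t (blockLength d k (t q)) ((blockStart t)^[k] q) ((blockStart t)^[k] q') := by
  induction k generalizing q q' with
  | zero => exact agreeAt_one.2 h
  | succ k ih =>
    rw [Function.iterate_succ_apply, Function.iterate_succ_apply, blockLength]
    have h0 := ih (q := blockStart t q) (q' := blockStart t q')
      (Fin.ext (by rw [ht.apply_blockStart, ht.apply_blockStart]))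
    rw [ht.apply_blockStart] at h0
    refine h0.append ?_
    split_ifs with hq
    · have hq' := hq
      rw [h] at hq'
      have h1 := ih (q := blockStart t q + 1) (q' := blockStart t q' + 1)
        (Fin.ext (by rw [ht.apply_blockStart_add_one q hq, ht.apply_blockStart_add_one q' hq', h]))
      rwa [ht.iterate_blockStart_succ, ht.iterate_blockStart_succ, ht.apply_blockStart_add_one q hq,
        ht.apply_blockStart, ht.apply_blockStart] at h1
    · intro x hx; omega

theorem bispecialLength_succ (d k : ℕ) :
    bispecialLength d (k + 1) = blockLength d k 0 + bispecialLength d k := by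
  rw [bispecialLength, Finset.sum_range_succ, add_comm]; rfl

/-- The bispecial prefix occurs at every block boundary. -/
theorem IsBonacciWord.agreeAt_bispecialLength (ht : IsBonacciWord d t) (k q q' : ℕ) :
    AgreeAt t (bispecialLength d k) ((blockStart t)^[k] q) ((blockStart t)^[k] q') := by
  induction k generalizing q q' with
  | zero => intro x hx; simp [bispecialLength] at hx
  | succ k ih =>
    rw [Function.iterate_succ_apply, Function.iterate_succ_apply, bispecialLength_succ]
    -- B_{k+1} = τ^k(0) B_k: every τ^{k+1}-block starts with τ^k(0), after which comes another
    -- τ^k-boundary.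
    have h0 := ht.agreeAt_iterate_blockStart k (q := blockStart t q) (q' := blockStart t q')
      (Fin.ext (by rw [ht.apply_blockStart, ht.apply_blockStart]))
    have h1 := ih (blockStart t q + 1) (blockStart t q' + 1)
    rw [ht.iterate_blockStart_succ, ht.iterate_blockStart_succ, ht.apply_blockStart,
      ht.apply_blockStart] at h1
    rw [ht.apply_blockStart] at h0
    exact h0.append h1

/-- This is the length form of B_{k+1} = τ(B_k) 0. -/
theorem IsBonacciWord.blockStart_bispecialLength (ht : IsBonacciWord d t) (k : ℕ) :
    blockStart t (bispecialLength d k) + 1 = bispecialLength d (k + 1) := by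
  induction k with
  | zero => simp [bispecialLength, blockStart, blockLength]
  | succ k ih =>
    have h1 := ht.agreeAt_bispecialLength k 1 0
    rw [iterate_blockStart_zero, ht.iterate_blockStart_one] at h1
    have h2 := h1.blockStart_add
    rw [← bispecialLength_succ, zero_add, blockStart, add_zero] at h2
    rw [h2, bispecialLength_succ d (k + 1), ← ih, ← ht.iterate_blockStart_one k,
      ← ht.iterate_blockStart_one (k + 1), Function.iterate_succ_apply']
    omega

/-- Long prefixes occur only at block boundaries. -/
theorem IsBonacciWord.exists_iterate_blockStart (ht : IsBonacciWord d t) {k i : ℕ}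
    (h : AgreeAt t (bispecialLength d k + 1) i 0) : ∃ q, i = (blockStart t)^[k + 1] q := by
  induction k generalizing i with
  | zero =>
    refine ht.exists_of_apply_eq_zero ?_
    rw [← ht.apply_zero]
    exact congrArg _ (h 0 (Nat.succ_pos _))
  | succ k ih =>
    obtain ⟨q, rfl⟩ := ht.exists_of_apply_eq_zero (x := i)
      (by rw [← ht.apply_zero]; exact congrArg _ (h 0 (Nat.succ_pos _)))
    -- Position 0 is put first because the length condition of desubstitution concerns the first
    -- position, where image lengths are known.
    have h1 : AgreeAt t (bispecialLength d k + 1) 0 q := by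
      refine ht.agreeAt_of_blockStart h.symm fun r hr => ?_
      have h2 := ht.blockStart_bispecialLength k
      have h3 := (blockStart_strictMono t).monotone (Nat.le_of_lt_succ hr)
      rw [zero_add, blockStart]
      omega
    obtain ⟨q', rfl⟩ := ih h1.symm
    exact ⟨q', by rw [← Function.iterate_succ_apply' (blockStart t)]⟩

end

/-! ### Block lengths and the two bounds on the complexity -/

section
variable {d : ℕ} {t : ℕ → Fin d}

theorem blockLength_pos (d k a : ℕ) : 0 < blockLength d k a := by
  induction k generalizing a with
  | zero => exact one_pos
  | succ k ih => exact Nat.add_pos_left (ih 0) _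

theorem blockLength_succ_le (d k a : ℕ) : blockLength d k (a + 1) ≤ blockLength d k a := by
  induction k generalizing a with
  | zero => exact le_rfl
  | succ k ih =>
    have := ih (a + 1)
    simp only [blockLength]
    split_ifs <;> omega

theorem blockLength_antitone (d k : ℕ) : Antitone (blockLength d k) :=
  antitone_nat_of_succ_le (blockLength_succ_le d k)

theorem blockLength_succ_zero (hd : 2 ≤ d) (k : ℕ) :
    blockLength d (k + 1) 0 = blockLength d k 0 + blockLength d k 1 := by
  rw [blockLength, if_pos (by omega)]

/-- Since b_{k+1} - n < D_k when n > b_k, this bound keeps the subtractions in the complexity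
formula from truncating. -/
theorem blockLength_zero_le_succ_one (d k : ℕ) :
    blockLength d k 0 ≤ blockLength d (k + 1) 1 := by
  rw [blockLength]
  omega

/-- No factor of length `n` repeats in a run of positions ending just before the second occurrence of
the next bispecial prefix. -/
theorem IsBonacciWord.mem_nonRepetitiveLengths (ht : IsBonacciWord d t) (hd : 2 ≤ d) {n k : ℕ}
    (hlow : bispecialLength d k < n) (hupp : n ≤ bispecialLength d (k + 1)) :
    blockLength d (k + 2) 0 - 1 - (bispecialLength d (k + 1) - n) ∈ nonRepetitiveLengths t n := by
  refine ⟨bispecialLength d (k + 1) - n + 1, fun i j hi hij hj heq => ?_⟩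
  rw [factorAt_eq_iff] at heq
  obtain ⟨a, ha, h1, h2⟩ := ht.exists_agreeAt_zero hij heq
  have hlt : j - a < blockLength d (k + 2) 0 := by omega
  -- If the extended factor fits in B_{k+1}, then a ≤ b_{k+1} - n, so the start of the run forces `i
  -- - a > 0`; only one positive τ^{k+1}-boundary lies below D_{k+2}. Otherwise both occurrences are
  -- at τ^{k+2}-boundaries, and 0 is the only one below D_{k+2}.
  rcases le_or_gt (n + a) (bispecialLength d (k + 1)) with hna | hna
  · obtain ⟨q, hq⟩ := ht.exists_iterate_blockStart (k := k) (h1.mono (by omega))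
    obtain ⟨q', hq'⟩ := ht.exists_iterate_blockStart (k := k) (h2.mono (by omega))
    have hmono := iterate_blockStart_strictMono t (k + 1)
    have hq0 : 0 < q := by
      rw [← hmono.lt_iff_lt, iterate_blockStart_zero]
      omega
    have hqq : q < q' := by
      rw [← hmono.lt_iff_lt]
      omega
    have : q' < 2 := by
      rw [← hmono.lt_iff_lt, ht.iterate_blockStart_two hd, ← hq']
      exact hlt
    omega
  · obtain ⟨q', hq'⟩ := ht.exists_iterate_blockStart (k := k + 1) (h2.mono (by omega))
    have hmono := iterate_blockStart_strictMono t (k + 2)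
    have : q' < 1 := by
      rw [← hmono.lt_iff_lt, ht.iterate_blockStart_one, ← hq']
      exact hlt
    obtain rfl : q' = 0 := by omega
    rw [iterate_blockStart_zero] at hq'
    omega

theorem StrictMono.exists_le_lt_succ {f : ℕ → ℕ} (hf : StrictMono f) (h0 : f 0 = 0) (l : ℕ) :
    ∃ q, f q ≤ l ∧ l < f (q + 1) := by
  have hex : ∃ q, l < f (q + 1) := ⟨l, (Nat.lt_succ_self l).trans_le (hf.le_apply (x := l + 1))⟩
  classical
  refine ⟨Nat.find hex, ?_, Nat.find_spec hex⟩
  rcases h : Nat.find hex with _ | q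
  · omega
  · exact not_lt.1 (Nat.find_min hex (m := q) (by omega))

/-- Every sufficiently long run of positions contains a repeated factor of length `n`. -/
theorem IsBonacciWord.le_of_mem_nonRepetitiveLengths (ht : IsBonacciWord d t) (hd : 2 ≤ d)
    {n k m : ℕ} (hlow : bispecialLength d k < n) (hupp : n ≤ bispecialLength d (k + 1))
    (hm : m ∈ nonRepetitiveLengths t n) :
    m ≤ blockLength d (k + 2) 0 - 1 - (bispecialLength d (k + 1) - n) := by
  obtain ⟨l, hl⟩ := hm
  by_contra! hlt
  have hb := bispecialLength_succ d k
  have hD : blockLength d (k + 2) 0 = _ := blockLength_succ_zero hd (k + 1)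
  have hD' := blockLength_zero_le_succ_one d k
  have hmono := iterate_blockStart_strictMono t (k + 1)
  obtain ⟨q, hq, hq1⟩ := hmono.exists_le_lt_succ (iterate_blockStart_zero t _) l
  have hs := ht.iterate_blockStart_succ (k + 1) q
  have hle := blockLength_antitone d (k + 1) (Nat.zero_le (t q))
  have hpos := blockLength_pos d (k + 1) (t q)
  have hocc := ht.agreeAt_bispecialLength (k + 1)
  obtain ⟨u, hu⟩ := Nat.exists_eq_add_of_le hq
  -- With u the offset of l in its block, agreement of the block starts over u + n letters makes the
  -- factor at l recur one block later, still inside the run.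
  have same : ∀ N, AgreeAt t N ((blockStart t)^[k + 1] q) ((blockStart t)^[k + 1] (q + 1)) →
      u + n ≤ N → False := by
    intro N hN huN
    refine hl l (l + blockLength d (k + 1) (t q)) le_rfl (by omega) (by omega) ?_
    rw [factorAt_eq_iff]
    convert (hN.mono huN).drop using 1
    omega
  rcases le_or_gt (u + n) (bispecialLength d (k + 1)) with hun | hun
  · exact same _ (hocc q (q + 1)) hun
  by_cases htq : t q = t (q + 1)
  · refine same (blockLength d (k + 1) (t q) + bispecialLength d (k + 1)) ?_ (by omega)
    refine (ht.agreeAt_iterate_blockStart (k + 1) htq).append ?_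
    rw [← hs]
    convert hocc (q + 1) (q + 2) using 1
    rw [ht.iterate_blockStart_succ (k + 1) (q + 1), htq]
  · have hs1 := ht.iterate_blockStart_succ (k + 1) (q + 1)
    have hpos1 := blockLength_pos d (k + 1) (t (q + 1))
    -- Of two distinct consecutive letters one is 0 and the other at least 1, and block lengths
    -- decrease with the letter. As u > b_{k+1} - n here, boundary q + 2 still falls inside the run.
    have hsum : blockLength d (k + 1) (t q) + blockLength d (k + 1) (t (q + 1)) ≤
        blockLength d (k + 2) 0 := by
      rw [hD]
      by_cases h0 : (t q : ℕ) = 0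
      · have h1 : 1 ≤ (t (q + 1) : ℕ) := by
          by_contra! h
          exact htq (Fin.ext (by omega))
        have := blockLength_antitone d (k + 1) h1
        rw [h0]
        omega
      · have h1 : 1 ≤ (t q : ℕ) := by omega
        have := blockLength_antitone d (k + 1) h1
        rw [ht.apply_succ_eq_zero h0]
        omega
    refine hl ((blockStart t)^[k + 1] (q + 1)) ((blockStart t)^[k + 1] (q + 1 + 1)) (by omega)
      (by omega) (by omega) ?_
    rw [factorAt_eq_iff]
    exact (hocc _ _).mono hupp

theorem IsBonacciWord.nonRepetitiveComplexity_eq (ht : IsBonacciWord d t) (hd : 2 ≤ d) {n k : ℕ}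
    (hlow : bispecialLength d k < n) (hupp : n ≤ bispecialLength d (k + 1)) :
    nonRepetitiveComplexity t n =
      blockLength d (k + 2) 0 - 1 - (bispecialLength d (k + 1) - n) :=
  (isGreatest_nonRepetitiveComplexity t n).unique
    ⟨ht.mem_nonRepetitiveLengths hd hlow hupp,
      fun _ hm => ht.le_of_mem_nonRepetitiveLengths hd hlow hupp hm⟩

/-! ### Arithmetic of the d-bonacci numbers -/

theorem bonacci_neg_one (d : ℕ) : bonacci d (-1) = 1 := by simp [bonacci]

theorem bonacci_of_lt (d : ℕ) {j : ℤ} (hj : j < -1) : bonacci d j = 0 := by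
  rw [bonacci, if_neg (by omega), if_neg (by omega)]

theorem bonacci_natCast (d j : ℕ) : bonacci d j = bonacciNat d j := by
  simp [bonacci]

/-- The window reaches D_{-1} = 1, which completes 1 + 2 + ⋯ + 2^{k-1} to 2^k. -/
theorem sum_bonacci_eq_two_pow {k m : ℕ} (hk : k ≤ d) (hm : k < m) :
    ∑ i ∈ Finset.range m, bonacci d ((k : ℤ) - 1 - i) = 2 ^ k := by
  induction k generalizing m with
  | zero =>
    obtain ⟨m, rfl⟩ := Nat.exists_eq_add_of_lt hm
    rw [Finset.sum_range_succ', Finset.sum_eq_zero]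
    · simp [bonacci_neg_one]
    · intro i _
      exact bonacci_of_lt d (by push_cast; omega)
  | succ k ih =>
    obtain _ | m := m
    · omega
    have h := ih (m := m) (by omega) (by omega)
    rw [Finset.sum_range_succ']
    have h1 : bonacci d (((k + 1 : ℕ) : ℤ) - 1 - (0 : ℕ)) = 2 ^ k := by
      rw [show ((k + 1 : ℕ) : ℤ) - 1 - (0 : ℕ) = (k : ℕ) by push_cast; ring, bonacci_natCast,
        bonacciNat, if_pos (by omega)]
    rw [h1, pow_succ, mul_two, ← h]
    congr 1
    refine Finset.sum_congr rfl fun i _ => ?_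
    congr 1
    push_cast
    ring

/-- The `d`-bonacci recursion, including the initial values. -/
theorem bonacci_eq_sum (d k : ℕ) :
    bonacci d k = ∑ i ∈ Finset.range d, bonacci d ((k : ℤ) - 1 - i) := by
  rcases lt_or_ge k d with hk | hk
  · rw [sum_bonacci_eq_two_pow hk.le hk, bonacci_natCast, bonacciNat, if_pos hk]
  · rw [bonacci_natCast, bonacciNat, if_neg (by omega),
      Fin.sum_univ_eq_sum_range (fun j => bonacciNat d (k - (j + 1)))]
    refine Finset.sum_congr rfl fun i hi => ?_
    rw [Finset.mem_range] at hi
    rw [← bonacci_natCast]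
    congr 1
    omega

theorem blockLength_eq_sum {a : ℕ} (ha : a < d) (k : ℕ) :
    blockLength d k a = ∑ i ∈ Finset.range (d - a), bonacci d ((k : ℤ) - 1 - i) := by
  induction k generalizing a with
  | zero =>
    rw [sum_bonacci_eq_two_pow (Nat.zero_le d) (by omega)]
    rfl
  | succ k ih =>
    rw [blockLength, ih (by omega), Nat.sub_zero, ← bonacci_eq_sum]
    obtain ⟨b, hb⟩ : ∃ b, d - a = b + 1 := ⟨d - a - 1, by omega⟩
    rw [hb, Finset.sum_range_succ', add_comm]
    congr 1
    · split_ifs with h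
      · rw [ih h, show d - (a + 1) = b by omega]
        refine Finset.sum_congr rfl fun i _ => ?_
        congr 1
        push_cast
        ring
      · obtain rfl : b = 0 := by omega
        rfl
    · congr 1
      push_cast
      ring

theorem blockLength_zero_eq_bonacci (hd : 0 < d) (k : ℕ) : blockLength d k 0 = bonacci d k := by
  rw [blockLength_eq_sum hd, Nat.sub_zero, ← bonacci_eq_sum]

/-- Summation by parts: shifting the index lowers each weight by one, and the boundary term has
weight d - d = 0. -/
theorem sum_mul_sub_eq (d : ℕ) (f : ℕ → ℚ) :
    ∑ i ∈ Finset.range d, ((d : ℚ) - i) * f i + ∑ i ∈ Finset.range d, f (i + 1) =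
      d * f 0 + ∑ i ∈ Finset.range d, ((d : ℚ) - i) * f (i + 1) := by
  have aux : ∀ m : ℕ, ∑ i ∈ Finset.range m, ((d : ℚ) - i) * f i + ∑ i ∈ Finset.range m, f (i + 1) =
      d * f 0 + ∑ i ∈ Finset.range m, ((d : ℚ) - i) * f (i + 1) - (d - m) * f m := by
    intro m
    induction m with
    | zero => simp
    | succ m ih =>
      rw [Finset.sum_range_succ, Finset.sum_range_succ, Finset.sum_range_succ]
      push_cast
      linarith
  rw [aux d]
  ring

theorem sum_mul_bonacci (hd : 0 < d) (k : ℕ) :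
    ∑ i ∈ Finset.range d, ((d : ℚ) - i) * (bonacci d ((k : ℤ) - i - 1) : ℚ) =
      d + (d - 1) * bispecialLength d k := by
  induction k with
  | zero =>
    obtain ⟨e, rfl⟩ := Nat.exists_eq_succ_of_ne_zero hd.ne'
    rw [Finset.sum_range_succ', Finset.sum_eq_zero]
    · simp [bonacci_neg_one, bispecialLength]
    · intro i _
      rw [bonacci_of_lt _ (by push_cast; omega)]
      simp
  | succ k ih =>
    -- With f(i) = D_{k-i} the unweighted sum is D_k by the recursion, so passing from k to k + 1
    -- adds (d-1) D_k.
    have h := sum_mul_sub_eq d fun i => (bonacci d ((k : ℤ) - i) : ℚ)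
    have h1 : ∑ i ∈ Finset.range d, (bonacci d ((k : ℤ) - (i + 1 : ℕ)) : ℚ) = bonacci d k := by
      rw [bonacci_eq_sum, Nat.cast_sum]
      refine Finset.sum_congr rfl fun i _ => ?_
      congr 2
      push_cast
      ring
    simp only [h1] at h
    rw [bispecialLength_succ, blockLength_zero_eq_bonacci hd]
    simp only [Nat.cast_add, Nat.cast_one, ← sub_sub, Nat.cast_zero, sub_zero] at h ⊢
    rw [ih] at h
    simp only [show ∀ i : ℕ, (k : ℤ) + 1 - i - 1 = k - i from fun i => by ring]
    linarith

theorem bispecialLength_eq (hd : 2 ≤ d) (k : ℕ) :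
    1 / ((d : ℚ) - 1) *
        ∑ i ∈ Finset.range d, ((d : ℚ) - i) * (bonacci d ((k : ℤ) - i - 1) : ℚ)
          - (d : ℚ) / ((d : ℚ) - 1) = bispecialLength d k := by
  have : (d : ℚ) - 1 ≠ 0 := by
    have : (2 : ℚ) ≤ d := by exact_mod_cast hd
    linarith
  rw [sum_mul_bonacci (by omega)]
  field_simp
  ring

end

theorem theorem20 (d : ℕ) (hd : 2 ≤ d) (t : ℕ → Fin d) (ht : IsBonacciWord d t)
    (n k : ℕ) (hn : 1 ≤ n) (hk : 1 ≤ k)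
    (hlow : 1 / ((d : ℚ) - 1) *
        ∑ i ∈ Finset.range d, ((d : ℚ) - i) * (bonacci d ((k : ℤ) - i - 2) : ℚ)
          - (d : ℚ) / ((d : ℚ) - 1) < n)
    (hupp : (n : ℚ) ≤ 1 / ((d : ℚ) - 1) *
        ∑ i ∈ Finset.range d, ((d : ℚ) - i) * (bonacci d ((k : ℤ) - i - 1) : ℚ)
          - (d : ℚ) / ((d : ℚ) - 1)) :
    (nonRepetitiveComplexity t n : ℚ) =
      (bonacci d ((k : ℤ) + 1) : ℚ) - 1
        - 1 / ((d : ℚ) - 1) *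
          ∑ i ∈ Finset.range d, ((d : ℚ) - i) * (bonacci d ((k : ℤ) - i - 1) : ℚ)
        + (d : ℚ) / ((d : ℚ) - 1) + n := by
  -- After this shift the hypotheses read b_k < n ≤ b_{k+1}.
  obtain ⟨k, rfl⟩ := Nat.exists_eq_add_of_le' hk
  have hP := bispecialLength_eq hd (k + 1)
  have hP' := bispecialLength_eq hd k
  simp only [show ∀ i : ℕ, ((k + 1 : ℕ) : ℤ) - i - 2 = k - i - 1 from fun i => by
    push_cast; ring] at hlow
  rw [hP', Nat.cast_lt] at hlow
  rw [hP, Nat.cast_le] at hupp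
  have hD : bonacci d (((k + 1 : ℕ) : ℤ) + 1) = blockLength d (k + 2) 0 := by
    rw [blockLength_zero_eq_bonacci (by omega)]
    rfl
  rw [ht.nonRepetitiveComplexity_eq hd hlow hupp, hD]
  have h1 := bispecialLength_succ d k
  have h2 : blockLength d (k + 2) 0 = _ := blockLength_succ_zero hd (k + 1)
  have h3 := blockLength_zero_le_succ_one d k
  have h4 := blockLength_pos d (k + 1) 0
  rw [Nat.sub_sub, Nat.cast_sub (by omega), Nat.cast_add, Nat.cast_sub hupp]
  push_cast at hP ⊢
  linarith
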